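/- \textbf{Definitions.} A constrained workflow authorization schema $W=(S,U,\leqslant,A,C)$ consists of a finite poset $(S,\leqslant)$ of steps, a finite set $U$ of users, an authorization relation $A\subseteq S\times U$ such that every step has at least one authorized user, and a finite set $C$ of constraints. In an instance of $\mathrm{WSP}_2(\neq)$ every constraint has the form $(\neq,S',S'')$ with $S',S''\subseteq S$ and at least one of $S',S''$ a singleton. A plan $\pi:S\to U$ satisfies this constraint if $\pi(s')\neq\pi(s'')$ for some $s'\in S'$, $s''\in S''$. A plan is valid if $(s,\pi(s))\in A$ for all $s\in S$ and it satisfies every constraint in $C$. Solving the problem means returning a valid plan, or the answer that no valid plan exists. The Exponential Time Hypothesis states that there is a real $\epsilon>0$ such that 3-SAT (satisfiability of a finite set of clauses, each with one, two or three literals, over $n$ variables) cannot be solved in time $O(2^{\epsilon n})$. Algorithms are deterministic Turing machines, and time is the number of steps. $\widetilde O(T)$ stands for $O(T\log^d T)$ with any constant $d$. \textbf{Theorem.} Assume the Exponential Time Hypothesis. Then there is a real $\epsilon>0$ such that $\mathrm{WSP}_2(\neq)$, even restricted to instances with exactly two users, cannot be solved in time $\widetilde O(2^{\epsilon k})$,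 where $k=|S|$ is the number of steps. This remains true if a further factor polynomial in the size of the instance is allowed: for no constants $C>0$ and $d,e\in\mathbb N$ does there exist an algorithm that solves each two-user instance, of size $N$ and with $k$ steps, within $C\,2^{\epsilon k}\,(1+\log 2^{\epsilon k})^d\,N^{e}$ steps. -/

import Mathlib

/-! ### Running time of algorithms

Algorithms are Mathlib's deterministic multi-stack Turing machines `Turing.FinTM2`, with binary
input and output; the running time is the number of machine steps. -/

/-- There is one Turing machine that, on the encoding of every instance `a`, halts after at most
`time a` steps with an output that is a correct answer for `a`. -/
def SolvableWithin {α : Type} (encode : α → List Bool) (correct : α → List Bool → Prop)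
    (time : α → ℝ) : Prop :=
  ∃ M : Turing.TM2ComputableAux Bool Bool, ∀ a : α, ∃ (out : List Bool) (t : ℕ),
    correct a out ∧ (t : ℝ) ≤ time a ∧
      Nonempty (Turing.TM2OutputsInTime M.tm ((encode a).map M.inputAlphabet.symm)
        (some (out.map M.outputAlphabet.symm)) t)

/-! ### Binary encodings -/

/-- Self-delimiting unary code of a natural number. -/
def encNat (n : ℕ) : List Bool := List.replicate n true ++ [false]

/-- Code of a list: every entry is announced by `true`, the end of the list by `false`. -/
def encList {α : Type} (enc : α → List Bool) (l : List α) : List Bool :=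
  l.flatMap (fun x => true :: enc x) ++ [false]

/-- The bit vector of a subset of `Fin k`. -/
def encSet {k : ℕ} (s : Finset (Fin k)) : List Bool := List.ofFn fun i => decide (i ∈ s)

/-- The bits of a Boolean matrix, row by row. -/
def encMatrix {p q : ℕ} (r : Fin p → Fin q → Bool) : List Bool :=
  (List.ofFn fun i => List.ofFn fun j => r i j).flatten

/-! ### 3-SAT and the Exponential Time Hypothesis -/

/-- A literal over `n` variables: `(v, true)` is the variable `v`, `(v, false)` its negation. -/
abbrev Literal (n : ℕ) := Fin n × Bool

/-- A clause `u ∨ v ∨ w`. Literals may be repeated, so shorter clauses are included. -/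
abbrev Clause (n : ℕ) := Fin 3 → Literal n

/-- A 3-CNF formula: a number of variables and a set of clauses, listed without repetition.
(Hence the size of a formula is polynomial in the number of variables.) -/
structure CNF3 where
  numVars : ℕ
  clauses : List (Clause numVars)
  nodup : clauses.Nodup

namespace CNF3

/-- Some truth assignment makes at least one literal of each clause true. -/
def Satisfiable (φ : CNF3) : Prop :=
  ∃ τ : Fin φ.numVars → Bool, ∀ c ∈ φ.clauses, ∃ i, τ (c i).1 = (c i).2

def encode (φ : CNF3) : List Bool :=
  encNat φ.numVars ++
    encList (fun c => (List.ofFn fun i => encNat (c i).1 ++ [(c i).2]).flatten) φ.clauses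

/-- The correct answer to the question whether `φ` is satisfiable: `1` for yes and `0` for no. -/
def Correct (φ : CNF3) (out : List Bool) : Prop :=
  (φ.Satisfiable ∧ out = [true]) ∨ (¬ φ.Satisfiable ∧ out = [false])

end CNF3

/-- The Exponential Time Hypothesis: there is a real `ε > 0` such that 3-SAT cannot be solved in
time `O(2 ^ (ε n))`, where `n` is the number of variables. -/
def ExponentialTimeHypothesis : Prop :=
  ∃ ε : ℝ, 0 < ε ∧ ∀ C : ℝ,
    ¬ SolvableWithin CNF3.encode CNF3.Correct fun φ => C * (2 : ℝ) ^ (ε * (φ.numVars : ℝ))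

/-! ### The workflow satisfiability problem -/

/-- An entailment constraint `(ρ, S', S'')` for `k` steps and `n` users. -/
@[ext]
structure Entailment (k n : ℕ) where
  rel : Fin n → Fin n → Bool
  left : Finset (Fin k)
  right : Finset (Fin k)

namespace Entailment

variable {k n : ℕ}

/-- A plan satisfies `(ρ, S', S'')` if `(π s', π s'') ∈ ρ` for some `s' ∈ S'` and `s'' ∈ S''`. -/
def SatisfiedBy (γ : Entailment k n) (π : Fin k → Fin n) : Prop :=
  ∃ s ∈ γ.left, ∃ s' ∈ γ.right, γ.rel (π s) (π s') = true

/-- The relation of the constraint is `≠`. -/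
def IsNe (γ : Entailment k n) : Prop := ∀ u v, γ.rel u v = true ↔ u ≠ v

/-- Constraints of Type at most 2: at least one of the two sets of steps is a singleton. -/
def IsType2 (γ : Entailment k n) : Prop := γ.left.card = 1 ∨ γ.right.card = 1

def encode (γ : Entailment k n) : List Bool :=
  encMatrix γ.rel ++ encSet γ.left ++ encSet γ.right

end Entailment

/-- A constrained workflow authorization schema `(S, U, ≤, A, C)` with entailment constraints:
a finite poset of steps, a finite set of users, an authorization relation under which every step
has an authorized user, and a set of constraints, listed without repetition. -/
structure Workflow where
  numSteps : ℕ
  numUsers : ℕ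
  le : Fin numSteps → Fin numSteps → Bool
  le_refl : ∀ s, le s s = true
  le_antisymm : ∀ s t, le s t = true → le t s = true → s = t
  le_trans : ∀ s t r, le s t = true → le t r = true → le s r = true
  auth : Fin numSteps → Fin numUsers → Bool
  exists_auth : ∀ s, ∃ u, auth s u = true
  constraints : List (Entailment numSteps numUsers)
  nodup : constraints.Nodup

namespace Workflow

/-- A plan is valid if it is authorized and satisfies all constraints. -/
def Valid (W : Workflow) (π : Fin W.numSteps → Fin W.numUsers) : Prop :=
  (∀ s, W.auth s (π s) = true) ∧ ∀ γ ∈ W.constraints, γ.SatisfiedBy π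

def encode (W : Workflow) : List Bool :=
  encNat W.numSteps ++ encNat W.numUsers ++ encMatrix W.le ++ encMatrix W.auth ++
    encList Entailment.encode W.constraints

/-- The correct answers: `1` followed by a valid plan, listed step by step, or `0` if there is no
valid plan. -/
def Correct (W : Workflow) (out : List Bool) : Prop :=
  (∃ π, W.Valid π ∧ out = true :: (List.ofFn fun s => encNat (π s)).flatten) ∨
    ((¬ ∃ π, W.Valid π) ∧ out = [false])

/-- The instances of `WSP₂(≠)` with exactly two users. -/
def IsTwoUserWSP2Ne (W : Workflow) : Prop :=
  W.numUsers = 2 ∧ ∀ γ ∈ W.constraints, γ.IsNe ∧ γ.IsType2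

end Workflow

/-- `WSP₂(≠)` restricted to two users (no behaviour is required on other inputs) can be solved in
the given time. -/
def TwoUserWSP2NeSolvableWithin (time : Workflow → ℝ) : Prop :=
  SolvableWithin (α := {W : Workflow // W.IsTwoUserWSP2Ne})
    (fun W => W.1.encode) (fun W => W.1.Correct) (fun W => time W.1)

/-! Two users can play the role of the truth values. Given a formula in `n` variables, take a step
`falseStep` whose user stands for `false` and three copies of each literal, one for each position
in a clause. If copies of complementary literals must be performed by different users, then all
copies of a literal are performed by the same user, and the plans are the truth assignments up to
exchanging the users. A clause becomes the constraint that some of its literals is not performed by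
the user of `falseStep`, which has one singleton side. The three positions make distinct clauses
yield distinct constraints, also when literals are repeated within a clause.

This workflow has `6 n + 1` steps, and a machine with unary counters writes it down in time
`O(n ^ 4)`. So an algorithm for `WSP₂(≠)` with exponent `ε = δ / 12` decides 3-SAT with exponent
`δ / 2`, up to a polynomial factor, which the remaining `2 ^ (δ n / 2)` absorbs. -/

open Function Turing

/-! ### Runs of step functions -/

/-- Iterating the step function `f` leads from `a` to `b` in at most `t` steps. -/
def ReachesWithin {C : Type} (f : C → Option C) (a b : C) (t : ℕ) : Prop :=
  Nonempty (StateTransition.EvalsToInTime f a (some b) t)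

namespace ReachesWithin

variable {C D : Type} {f : C → Option C} {g : D → Option D} {a b c : C} {t u : ℕ}

theorem refl (f : C → Option C) (a : C) : ReachesWithin f a a 0 := ⟨.refl f a⟩

theorem of_step (h : f a = some b) : ReachesWithin f a b 1 := ⟨⟨⟨1, h⟩, le_rfl⟩⟩

theorem mono (h : ReachesWithin f a b t) (htu : t ≤ u) : ReachesWithin f a b u :=
  h.elim fun r => ⟨⟨r.toEvalsTo, r.steps_le_m.trans htu⟩⟩

theorem trans (h₁ : ReachesWithin f a b t) (h₂ : ReachesWithin f b c u) :
    ReachesWithin f a c (t + u) :=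
  h₁.elim fun r₁ => h₂.elim fun r₂ => ⟨add_comm u t ▸ r₁.trans f t u a b (some c) r₂⟩

theorem map (e : C → D) (he : ∀ a b, f a = some b → g (e a) = some (e b))
    (h : ReachesWithin f a b t) : ReachesWithin g (e a) (e b) t := by
  obtain ⟨⟨⟨n, hn⟩, hnt⟩⟩ := h
  refine ⟨⟨⟨n, ?_⟩, hnt⟩⟩
  clear hnt
  have iterate_none : ∀ m, (flip bind f)^[m] none = none := fun m => iterate_fixed rfl m
  induction n generalizing a with
  | zero =>
    obtain rfl : a = b := Option.some_injective _ hn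
    rfl
  | succ n ih =>
    rw [iterate_succ_apply] at hn ⊢
    change (flip bind f)^[n] (f a) = some b at hn
    change (flip bind g)^[n] (g (e a)) = some (e b)
    obtain hfa | ⟨a', hfa⟩ := (f a).eq_none_or_eq_some
    · rw [hfa, iterate_none] at hn
      cases hn
    · rw [hfa] at hn
      rw [he a a' hfa]
      exact ih hn

end ReachesWithin

/-! ### Composition of Turing machines -/

theorem initList_eq_update (tm : FinTM2) (x : List (tm.Γ tm.k₀)) :
    initList tm x = ⟨some tm.main, tm.initialState, update (fun _ => []) tm.k₀ x⟩ := by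
  refine congrArg (TM2.Cfg.mk _ _) (funext fun k => ?_)
  by_cases h : k = tm.k₀
  · subst h
    simp
  · simp [h]

theorem haltList_eq_update (tm : FinTM2) (x : List (tm.Γ tm.k₁)) :
    haltList tm x = ⟨none, tm.initialState, update (fun _ => []) tm.k₁ x⟩ := by
  refine congrArg (TM2.Cfg.mk _ _) (funext fun k => ?_)
  by_cases h : k = tm.k₁
  · subst h
    simp
  · simp [h]

/-- On input `x`, the machine halts within `t` steps with output `y`. -/
def Computes {A B : Type} (M : TM2ComputableAux A B) (x : List A) (t : ℕ) (y : List B) : Prop :=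
  Nonempty (TM2OutputsInTime M.tm (x.map M.inputAlphabet.symm)
    (some (y.map M.outputAlphabet.symm)) t)

theorem computes_iff_reachesWithin {A B : Type} {M : TM2ComputableAux A B} {x : List A} {t : ℕ}
    {y : List B} :
    Computes M x t y ↔ ReachesWithin (TM2.step M.tm.m)
      ⟨some M.tm.main, M.tm.initialState,
        update (fun _ => []) M.tm.k₀ (x.map M.inputAlphabet.symm)⟩
      ⟨none, M.tm.initialState,
        update (fun _ => []) M.tm.k₁ (y.map M.outputAlphabet.symm)⟩ t := by
  rw [← initList_eq_update, ← haltList_eq_update]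
  rfl

/-- A way to run the statements of one machine on a bigger one: `ι` sends its stacks to stacks of
the bigger machine, `put` and `place` extend its internal states and stack contents. -/
structure TM2Embedding {K K' : Type} [DecidableEq K] [DecidableEq K'] (ι : K → K')
    (Γ' : K' → Type) (σ σ' : Type) where
  get : σ' → σ
  put : σ → σ'
  place : (∀ k, List (Γ' (ι k))) → ∀ k, List (Γ' k)
  get_put : ∀ v, get (put v) = v
  place_apply : ∀ S k, place S (ι k) = S k
  update_place : ∀ S k x, update (place S) (ι k) x = place (update S k x)

namespace TM2Embedding

variable {K K' : Type} [DecidableEq K] [DecidableEq K'] {ι : K → K'} {Γ' : K' → Type}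
  {σ σ' Λ Λ' : Type}

attribute [simp] get_put place_apply update_place

/-- The statement of the bigger machine that simulates a given one. Instead of halting, it jumps
to `exit` if this is a label. -/
def stmt (E : TM2Embedding ι Γ' σ σ') (lbl : Λ → Λ') (exit : Option Λ') :
    TM2.Stmt (fun k => Γ' (ι k)) Λ σ → TM2.Stmt Γ' Λ' σ'
  | .push k f q => .push (ι k) (fun v => f (E.get v)) (E.stmt lbl exit q)
  | .peek k f q => .peek (ι k) (fun v o => E.put (f (E.get v) o)) (E.stmt lbl exit q)
  | .pop k f q => .pop (ι k) (fun v o => E.put (f (E.get v) o)) (E.stmt lbl exit q)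
  | .load f q => .load (fun v => E.put (f (E.get v))) (E.stmt lbl exit q)
  | .branch f q r => .branch (fun v => f (E.get v)) (E.stmt lbl exit q) (E.stmt lbl exit r)
  | .goto f => .goto fun v => lbl (f (E.get v))
  | .halt => exit.elim .halt fun l => .goto fun _ => l

/-- The configuration of the bigger machine that simulates a given one. -/
def cfg (E : TM2Embedding ι Γ' σ σ') (lbl : Λ → Λ') (exit : Option Λ')
    (c : TM2.Cfg (fun k => Γ' (ι k)) Λ σ) : TM2.Cfg Γ' Λ' σ' :=
  ⟨c.l.elim exit (some ∘ lbl), E.put c.var, E.place c.stk⟩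

theorem stepAux_stmt (E : TM2Embedding ι Γ' σ σ') (lbl : Λ → Λ') (exit : Option Λ')
    (q : TM2.Stmt (fun k => Γ' (ι k)) Λ σ) (v : σ) (S : ∀ k, List (Γ' (ι k))) :
    TM2.stepAux (E.stmt lbl exit q) (E.put v) (E.place S) =
      E.cfg lbl exit (TM2.stepAux q v S) := by
  induction q generalizing v S with
  | push k f q ih => simpa [stmt] using ih v (update S k (f v :: S k))
  | peek k f q ih => simpa [stmt] using ih (f v (S k).head?) S
  | pop k f q ih => simpa [stmt] using ih (f v (S k).head?) (update S k (S k).tail)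
  | load f q ih => simpa [stmt] using ih (f v) S
  | branch f q r ihq ihr => cases h : f v <;> simp [stmt, h, ihq, ihr]
  | goto f => simp [stmt, cfg]
  | halt => cases exit <;> rfl

theorem reachesWithin (E : TM2Embedding ι Γ' σ σ') {lbl : Λ → Λ'} {exit : Option Λ'}
    {m : Λ → TM2.Stmt (fun k => Γ' (ι k)) Λ σ} {m' : Λ' → TM2.Stmt Γ' Λ' σ'}
    (hm : ∀ l, m' (lbl l) = E.stmt lbl exit (m l)) {a b : TM2.Cfg (fun k => Γ' (ι k)) Λ σ} {t : ℕ}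
    (h : ReachesWithin (TM2.step m) a b t) :
    ReachesWithin (TM2.step m') (E.cfg lbl exit a) (E.cfg lbl exit b) t := by
  refine h.map _ fun a b hab => ?_
  obtain ⟨_ | l, v, S⟩ := a
  · cases hab
  · obtain rfl : TM2.stepAux (m l) v S = b := Option.some_injective _ hab
    rw [← E.stepAux_stmt, ← hm]
    rfl

end TM2Embedding

section Comp

variable {A B C : Type}

/-- The stack alphabets of two machines put side by side. -/
abbrev JoinΓ (M₁ M₂ : FinTM2) : M₁.K ⊕ M₂.K → Type
  | .inl k => M₁.Γ k
  | .inr k => M₂.Γ k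

/-- The contents of the stacks of two machines put side by side. -/
def joinStacks {M₁ M₂ : FinTM2} (S : ∀ k, List (M₁.Γ k)) (T : ∀ k, List (M₂.Γ k)) :
    ∀ k, List (JoinΓ M₁ M₂ k)
  | .inl k => S k
  | .inr k => T k

section joinStacks

variable {M₁ M₂ : FinTM2} (S : ∀ k, List (M₁.Γ k)) (T : ∀ k, List (M₂.Γ k))

@[simp]
theorem joinStacks_inl (k : M₁.K) : joinStacks S T (.inl k) = S k := rfl

@[simp]
theorem joinStacks_inr (k : M₂.K) : joinStacks S T (.inr k) = T k := rfl

theorem joinStacks_nil :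
    (joinStacks (fun _ => []) (fun _ => []) : ∀ k, List (JoinΓ M₁ M₂ k)) = fun _ => [] := by
  funext k
  cases k <;> rfl

@[simp]
theorem update_joinStacks_inl (k : M₁.K) (x : List (M₁.Γ k)) :
    update (joinStacks S T) (.inl k) x = joinStacks (update S k x) T := by
  funext j
  rcases j with j | j
  · obtain rfl | h := eq_or_ne j k <;> simp [*]
  · simp

@[simp]
theorem update_joinStacks_inr (k : M₂.K) (x : List (M₂.Γ k)) :
    update (joinStacks S T) (.inr k) x = joinStacks S (update T k x) := by
  funext j
  rcases j with j | j
  · simp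
  · obtain rfl | h := eq_or_ne j k <;> simp [*]

theorem update_nil_inl (k : M₁.K) (x : List (M₁.Γ k)) :
    update (fun _ => [] : ∀ k, List (JoinΓ M₁ M₂ k)) (.inl k) x =
      joinStacks (update (fun _ => []) k x) fun _ => [] := by
  rw [← update_joinStacks_inl, joinStacks_nil]

theorem update_nil_inr (k : M₂.K) (x : List (M₂.Γ k)) :
    update (fun _ => [] : ∀ k, List (JoinΓ M₁ M₂ k)) (.inr k) x =
      joinStacks (fun _ => []) (update (fun _ => []) k x) := by
  rw [← update_joinStacks_inr, joinStacks_nil]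

end joinStacks

/-- The internal states of the composition of two machines; the last component buffers the symbol
that is being handed over. -/
abbrev JoinState (M₁ M₂ : FinTM2) : Type := M₁.σ × M₂.σ × Option (M₂.Γ M₂.k₀)

/-- The first of two machines as a part of their composition. -/
def leftEmbedding (M₁ M₂ : FinTM2) :
    TM2Embedding (Sum.inl : M₁.K → M₁.K ⊕ M₂.K) (JoinΓ M₁ M₂) M₁.σ (JoinState M₁ M₂) where
  get v := v.1
  put v := (v, M₂.initialState, none)
  place S := joinStacks S fun _ => []
  get_put _ := rfl
  place_apply _ _ := rfl
  update_place _ _ _ := update_joinStacks_inl _ _ _ _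

/-- The second of two machines as a part of their composition. -/
def rightEmbedding (M₁ M₂ : FinTM2) :
    TM2Embedding (Sum.inr : M₂.K → M₁.K ⊕ M₂.K) (JoinΓ M₁ M₂) M₂.σ (JoinState M₁ M₂) where
  get v := v.2.1
  put v := (M₁.initialState, v, none)
  place S := joinStacks (fun _ => []) S
  get_put _ := rfl
  place_apply _ _ := rfl
  update_place _ _ _ := update_joinStacks_inr _ _ _ _

/-- One round of the loop that moves the output of `M₁` to the input stack of `M₂`. -/
def transferStmt [Inhabited B] (M₁ : TM2ComputableAux A B) (M₂ : TM2ComputableAux B C) :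
    TM2.Stmt (JoinΓ M₁.tm M₂.tm) (Option (M₁.tm.Λ ⊕ M₂.tm.Λ)) (JoinState M₁.tm M₂.tm) :=
  .pop (.inl M₁.tm.k₁)
      (fun v o => (v.1, v.2.1, o.map (M₂.inputAlphabet.symm ∘ M₁.outputAlphabet))) <|
    .branch (fun v => v.2.2.isSome)
      (.push (.inr M₂.tm.k₀) (fun v => v.2.2.getD (M₂.inputAlphabet.symm default)) <|
        .load (fun v => (v.1, v.2.1, none)) <| .goto fun _ => none)
      (.goto fun _ => some (.inr M₂.tm.main))

/-- The code of `compReverse M₁ M₂`. -/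
def compCode [Inhabited B] (M₁ : TM2ComputableAux A B) (M₂ : TM2ComputableAux B C) :
    Option (M₁.tm.Λ ⊕ M₂.tm.Λ) →
      TM2.Stmt (JoinΓ M₁.tm M₂.tm) (Option (M₁.tm.Λ ⊕ M₂.tm.Λ)) (JoinState M₁.tm M₂.tm)
  | none => transferStmt M₁ M₂
  | some (.inl l) => (leftEmbedding M₁.tm M₂.tm).stmt (some ∘ .inl) (some none) (M₁.tm.m l)
  | some (.inr l) => (rightEmbedding M₁.tm M₂.tm).stmt (some ∘ .inr) none (M₂.tm.m l)

/-- Runs `M₁`, moves its output symbol by symbol to the input stack of `M₂`, and runs `M₂`. The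
move reverses the word, and nothing is done to restore its order. -/
def compReverse [Inhabited B] (M₁ : TM2ComputableAux A B) (M₂ : TM2ComputableAux B C) :
    TM2ComputableAux A C where
  tm :=
    let := M₁.tm.kFin
    let := M₂.tm.kFin
    let := M₁.tm.ΛFin
    let := M₂.tm.ΛFin
    let := M₁.tm.σFin
    let := M₂.tm.σFin
    let := M₂.tm.Γk₀Fin
    { K := M₁.tm.K ⊕ M₂.tm.K
      k₀ := .inl M₁.tm.k₀
      k₁ := .inr M₂.tm.k₁
      Γ := JoinΓ M₁.tm M₂.tm
      Γk₀Fin := M₁.tm.Γk₀Fin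
      Λ := Option (M₁.tm.Λ ⊕ M₂.tm.Λ)
      main := some (.inl M₁.tm.main)
      σ := JoinState M₁.tm M₂.tm
      initialState := (M₁.tm.initialState, M₂.tm.initialState, none)
      m := compCode M₁ M₂ }
  inputAlphabet := M₁.inputAlphabet
  outputAlphabet := M₂.outputAlphabet

/-- The configuration of `compReverse M₁ M₂` at the label `l` in which `y` is still to be moved
and `w` has already been moved. -/
def transferCfg (M₁ : TM2ComputableAux A B) (M₂ : TM2ComputableAux B C)
    (l : Option (M₁.tm.Λ ⊕ M₂.tm.Λ)) (y w : List B) :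
    TM2.Cfg (JoinΓ M₁.tm M₂.tm) (Option (M₁.tm.Λ ⊕ M₂.tm.Λ)) (JoinState M₁.tm M₂.tm) :=
  ⟨some l, (M₁.tm.initialState, M₂.tm.initialState, none),
    joinStacks (update (fun _ => []) M₁.tm.k₁ (y.map M₁.outputAlphabet.symm))
      (update (fun _ => []) M₂.tm.k₀ (w.map M₂.inputAlphabet.symm))⟩

variable [Inhabited B] {M₁ : TM2ComputableAux A B} {M₂ : TM2ComputableAux B C}

theorem transferCfg_reachesWithin (y w : List B) :
    ReachesWithin (TM2.step (compCode M₁ M₂)) (transferCfg M₁ M₂ none y w)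
      (transferCfg M₁ M₂ (some (.inr M₂.tm.main)) [] (y.reverse ++ w)) (y.length + 1) := by
  induction y generalizing w with
  | nil =>
    refine .of_step ?_
    simp [transferCfg, TM2.step, compCode, transferStmt]
  | cons b y ih =>
    have round : TM2.step (compCode M₁ M₂) (transferCfg M₁ M₂ none (b :: y) w) =
        some (transferCfg M₁ M₂ none y (b :: w)) := by
      simp [transferCfg, TM2.step, compCode, transferStmt]
    simpa [add_comm] using (ReachesWithin.of_step round).trans (ih (b :: w))

theorem Computes.compReverse {x : List A} {y : List B} {z : List C} {t u : ℕ}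
    (h₁ : Computes M₁ x t y.reverse) (h₂ : Computes M₂ y u z) :
    Computes (compReverse M₁ M₂) x (t + (y.length + 1) + u) z := by
  rw [computes_iff_reachesWithin] at h₁ h₂ ⊢
  have run₁ := (leftEmbedding M₁.tm M₂.tm).reachesWithin (lbl := some ∘ .inl)
    (exit := some none) (m' := compCode M₁ M₂) (fun _ => rfl) h₁
  have move := transferCfg_reachesWithin (M₁ := M₁) (M₂ := M₂) y.reverse []
  have run₂ := (rightEmbedding M₁.tm M₂.tm).reachesWithin (lbl := some ∘ .inr)
    (exit := none) (m' := compCode M₁ M₂) (fun _ => rfl) h₂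
  simp only [transferCfg, List.map_reverse, List.map_nil, update_eq_self, List.reverse_reverse,
    List.append_nil, List.length_reverse] at move
  simp only [TM2Embedding.cfg, Option.elim_some, comp_apply, leftEmbedding, Option.elim_none,
    List.map_reverse, rightEmbedding] at run₁ run₂
  have run := (run₁.trans move).trans run₂
  rw [← update_nil_inl, ← update_nil_inr] at run
  exact run

end Comp

/-! ### Stack programs -/

/-- Structured programs acting on stacks of bits that are indexed by `K`. -/
inductive StackProg (K : Type) : Type
  | skip : StackProg K
  | push (k : K) (b : Bool) : StackProg K
  | seq (p q : StackProg K) : StackProg K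
  /-- Pop a bit from `k` and continue with `p`, `q` or `r` according as the stack was empty,
  the bit is `false`, or the bit is `true`. -/
  | case (k : K) (p q r : StackProg K) : StackProg K
  /-- Pop a bit from `k`; as long as it is `true`, run `p` and repeat. -/
  | loop (k : K) (p : StackProg K) : StackProg K

namespace StackProg

variable {K : Type}

/-- `Runs p s t s'`: started on the stacks `s`, the program `p` ends on the stacks `s'` after at
most `t` steps. -/
inductive Runs [DecidableEq K] :
    StackProg K → (K → List Bool) → ℕ → (K → List Bool) → Prop
  | skip {s} : Runs skip s 0 s
  | push {k b s} : Runs (push k b) s 1 (update s k (b :: s k))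
  | seq {p q s t s' u s''} (hp : Runs p s t s') (hq : Runs q s' u s'') :
      Runs (seq p q) s (t + u) s''
  | case_nil {k p q r s t s'} (hk : s k = []) (hp : Runs p s t s') :
      Runs (case k p q r) s (1 + t) s'
  | case_false {k p q r s l t s'} (hk : s k = false :: l) (hq : Runs q (update s k l) t s') :
      Runs (case k p q r) s (1 + t) s'
  | case_true {k p q r s l t s'} (hk : s k = true :: l) (hr : Runs r (update s k l) t s') :
      Runs (case k p q r) s (1 + t) s'
  | loop_nil {k p s} (hk : s k = []) : Runs (loop k p) s 1 s
  | loop_false {k p s l} (hk : s k = false :: l) : Runs (loop k p) s 1 (update s k l)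
  | loop_true {k p s l t s' u s''} (hk : s k = true :: l) (hp : Runs p (update s k l) t s')
      (hl : Runs (loop k p) s' u s'') : Runs (loop k p) s (1 + t + u) s''
  | mono {p s t s' u} (h : Runs p s t s') (htu : t ≤ u) : Runs p s u s'

section Compile

/-- The labels of the machine code of a program. -/
def Label : StackProg K → Type
  | skip => Empty
  | push _ _ => Unit
  | seq p q => p.Label ⊕ q.Label
  | case _ p q r => Option (p.Label ⊕ q.Label ⊕ r.Label)
  | loop _ p => Option p.Label

instance instFintypeLabel : (p : StackProg K) → Fintype p.Label
  | skip => inferInstanceAs (Fintype Empty)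
  | push _ _ => inferInstanceAs (Fintype Unit)
  | seq p q =>
    have := instFintypeLabel p
    have := instFintypeLabel q
    inferInstanceAs (Fintype (p.Label ⊕ q.Label))
  | case _ p q r =>
    have := instFintypeLabel p
    have := instFintypeLabel q
    have := instFintypeLabel r
    inferInstanceAs (Fintype (Option (p.Label ⊕ q.Label ⊕ r.Label)))
  | loop _ p =>
    have := instFintypeLabel p
    inferInstanceAs (Fintype (Option p.Label))

variable {Λ : Type}

/-- The label at which the code of a program starts, if `emb` embeds its labels into the labels of
a machine and the code ends with a jump to `exit`. -/
def entry : (p : StackProg K) → (p.Label → Λ) → Λ → Λ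
  | skip, _, exit => exit
  | push _ _, emb, _ => emb ()
  | seq p q, emb, exit => p.entry (emb ∘ .inl) (q.entry (emb ∘ .inr) exit)
  | case _ _ _ _, emb, _ => emb none
  | loop _ _, emb, _ => emb none

/-- Forget the bit that was popped last, and jump. -/
def clearGoto (l : Λ) : TM2.Stmt (fun _ : K => Bool) Λ (Option Bool) :=
  .load (fun _ => none) (.goto fun _ => l)

/-- The machine code of a program. The internal state holds the bit that was popped last. -/
def code : (p : StackProg K) → (p.Label → Λ) → Λ → p.Label →
    TM2.Stmt (fun _ : K => Bool) Λ (Option Bool)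
  | skip, _, _, l => nomatch l
  | push k b, _, exit, _ => .push k (fun _ => b) (clearGoto exit)
  | seq p q, emb, exit, .inl l => p.code (emb ∘ .inl) (q.entry (emb ∘ .inr) exit) l
  | seq _ q, emb, exit, .inr l => q.code (emb ∘ .inr) exit l
  | case k p q r, emb, exit, none =>
    .pop k (fun _ o => o) <|
      .branch Option.isNone
        (clearGoto (p.entry (fun l => emb (some (.inl l))) exit)) <|
        .branch (· == some true)
          (clearGoto (r.entry (fun l => emb (some (.inr (.inr l)))) exit))
          (clearGoto (q.entry (fun l => emb (some (.inr (.inl l)))) exit))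
  | case _ p _ _, emb, exit, some (.inl l) => p.code (fun l => emb (some (.inl l))) exit l
  | case _ _ q _, emb, exit, some (.inr (.inl l)) =>
    q.code (fun l => emb (some (.inr (.inl l)))) exit l
  | case _ _ _ r, emb, exit, some (.inr (.inr l)) =>
    r.code (fun l => emb (some (.inr (.inr l)))) exit l
  | loop k p, emb, exit, none =>
    .pop k (fun _ o => o) <|
      .branch (· == some true) (clearGoto (p.entry (fun l => emb (some l)) (emb none)))
        (clearGoto exit)
  | loop _ p, emb, _, some l => p.code (fun l => emb (some l)) (emb none) l

variable [DecidableEq K]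

theorem update_eq_self_of_nil {s : K → List Bool} {k : K} (hk : s k = []) : update s k [] = s := by
  rw [← hk, update_eq_self]

theorem step_of_eq_code {M : Λ → TM2.Stmt (fun _ : K => Bool) Λ (Option Bool)} {l : Λ}
    {q : TM2.Stmt (fun _ : K => Bool) Λ (Option Bool)} (hl : M l = q) (s : K → List Bool) :
    TM2.step M ⟨some l, none, s⟩ = some (TM2.stepAux q none s) :=
  hl ▸ rfl

theorem Runs.reachesWithin {p : StackProg K} {s s' : K → List Bool} {t : ℕ} (h : p.Runs s t s')
    {M : Λ → TM2.Stmt (fun _ : K => Bool) Λ (Option Bool)} {emb : p.Label → Λ} {exit : Λ}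
    (hM : ∀ l, M (emb l) = p.code emb exit l) :
    ReachesWithin (TM2.step M) ⟨some (p.entry emb exit), none, s⟩ ⟨some exit, none, s'⟩ t := by
  induction h generalizing exit with
  | skip => exact .refl _ _
  | push =>
    refine .of_step ((step_of_eq_code (hM ()) _).trans ?_)
    simp [code, clearGoto]
  | seq _ _ ihp ihq => exact (ihp fun l => hM (.inl l)).trans (ihq fun l => hM (.inr l))
  | case_nil hk _ ih =>
    refine .trans (.of_step ((step_of_eq_code (hM none) _).trans ?_))
      (ih fun l => hM (some (.inl l)))
    simp [code, clearGoto, hk, update_eq_self_of_nil]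
  | case_false hk _ ih =>
    refine .trans (.of_step ((step_of_eq_code (hM none) _).trans ?_))
      (ih fun l => hM (some (.inr (.inl l))))
    simp [code, clearGoto, hk]
  | case_true hk _ ih =>
    refine .trans (.of_step ((step_of_eq_code (hM none) _).trans ?_))
      (ih fun l => hM (some (.inr (.inr l))))
    simp [code, clearGoto, hk]
  | loop_nil hk =>
    refine .of_step ((step_of_eq_code (hM none) _).trans ?_)
    simp [code, clearGoto, hk, update_eq_self_of_nil]
  | loop_false hk =>
    refine .of_step ((step_of_eq_code (hM none) _).trans ?_)
    simp [code, clearGoto, hk]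
  | loop_true hk _ _ ihp ihl =>
    refine .trans (.trans (.of_step ((step_of_eq_code (hM none) _).trans ?_))
      (ihp fun l => hM (some l))) (ihl hM)
    simp [code, clearGoto, hk]
  | mono _ htu ih => exact (ih hM).mono htu

/-- The machine that runs a program with its input on the stack `inp` and its output on the stack
`out`. -/
def toMachine [Fintype K] (p : StackProg K) (inp out : K) : TM2ComputableAux Bool Bool where
  tm :=
    { k₀ := inp
      k₁ := out
      Γ := fun _ => Bool
      Λ := Option p.Label
      main := p.entry some none
      σ := Option Bool
      initialState := none
      Γk₀Fin := inferInstanceAs (Fintype Bool)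
      m
        | some l => p.code some none l
        | none => .halt }
  inputAlphabet := .refl _
  outputAlphabet := .refl _

theorem Runs.computes [Fintype K] {p : StackProg K} {inp out : K} {x y : List Bool} {t : ℕ}
    (h : p.Runs (update (fun _ => []) inp x) t (update (fun _ => []) out y)) :
    Computes (p.toMachine inp out) x (t + 1) y := by
  have hmap (l : List Bool) : l.map (Equiv.refl Bool).symm = l := l.map_id
  have run := (h.reachesWithin (M := (p.toMachine inp out).tm.m) (emb := some) (exit := none)
    fun _ => rfl).trans (.of_step rfl)
  rw [computes_iff_reachesWithin]
  rwa [← hmap x, ← hmap y] at run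

end Compile

theorem Runs.length_le [DecidableEq K] {p : StackProg K} {s s' : K → List Bool} {t : ℕ}
    (h : p.Runs s t s') (k : K) : (s' k).length ≤ (s k).length + t := by
  induction h with
  | skip => rfl
  | @push j => obtain rfl | hj := eq_or_ne k j <;> simp [*]
  | seq | case_nil | loop_nil | mono => lia
  | @case_false j | @case_true j | @loop_false j | @loop_true j =>
    obtain rfl | hj := eq_or_ne k j <;> simp_all <;> lia

end StackProg

/-- Unary counters of the programs below. A pass over the variables of a formula keeps the index
of the current variable in `var` and the number of later variables in `rest`. -/
inductive Counter
  | var | rest | tmp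
  deriving DecidableEq

instance : Fintype Counter := ⟨{.var, .rest, .tmp}, fun c => by cases c <;> decide⟩

/-- The stacks of the programs below: input, output and the counters. -/
inductive Stack
  | inp | out | cnt (c : Counter)
  deriving DecidableEq, Fintype

open Counter Stack

/-- Values of the counters. -/
def counters (v r m : ℕ) : Counter → ℕ
  | var => v
  | rest => r
  | tmp => m

/-- The stacks with given input, output and counter values. -/
def contents (i o : List Bool) (n : Counter → ℕ) : Stack → List Bool
  | inp => i
  | out => o
  | cnt c => List.replicate (n c) true

@[simp] theorem contents_inp (i o n) : contents i o n inp = i := rfl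

@[simp] theorem contents_out (i o n) : contents i o n out = o := rfl

@[simp] theorem contents_cnt (i o n c) : contents i o n (cnt c) = List.replicate (n c) true := rfl

section Update

variable (i o x : List Bool) (n : Counter → ℕ) (v r m k : ℕ)

@[simp] theorem update_counters_var : update (counters v r m) var k = counters k r m := by
  funext c; cases c <;> rfl

@[simp] theorem update_counters_rest : update (counters v r m) rest k = counters v k m := by
  funext c; cases c <;> rfl

@[simp] theorem update_contents_inp : update (contents i o n) inp x = contents x o n := by
  funext c; cases c <;> rfl

@[simp] theorem update_contents_out : update (contents i o n) out x = contents i x n := by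
  funext c; cases c <;> rfl

@[simp]
theorem update_contents_cnt (c : Counter) :
    update (contents i o n) (cnt c) (List.replicate k true) = contents i o (update n c k) := by
  funext j
  rcases j with _ | _ | j
  · rfl
  · rfl
  · obtain rfl | h := eq_or_ne j c <;> simp [contents, *]

theorem update_nil_inp : update (fun _ => []) inp x = contents x [] (counters 0 0 0) := by
  funext c
  rcases c with _ | _ | _ | _ | _ <;> rfl

theorem update_nil_out : update (fun _ => []) out x = contents [] x (counters 0 0 0) := by
  funext c
  rcases c with _ | _ | _ | _ | _ <;> rfl

@[simp]
theorem update_contents_cnt_nil (c : Counter) :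
    update (contents i o n) (cnt c) [] = contents i o (update n c 0) :=
  update_contents_cnt i o n 0 c

end Update

namespace StackProg

/-- Removes the top bit of the stack `k`, if there is one. -/
def pop {K : Type} (k : K) : StackProg K := case k skip skip skip

theorem runs_pop {K : Type} [DecidableEq K] (k : K) (s : K → List Bool) :
    (pop k).Runs s 1 (update s k (s k).tail) := by
  rcases h : s k with _ | ⟨_ | _, l⟩
  · rw [List.tail_nil, update_eq_self_of_nil h]
    exact .case_nil h .skip
  · exact .case_false h .skip
  · exact .case_true h .skip

theorem runs_push_out (b : Bool) (i o : List Bool) (n : Counter → ℕ) :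
    (push out b).Runs (contents i o n) 1 (contents i (b :: o) n) := by
  simpa using Runs.push (k := out) (b := b) (s := contents i o n)

theorem runs_push_cnt (c : Counter) (i o : List Bool) (n : Counter → ℕ) :
    (push (cnt c) true).Runs (contents i o n) 1 (contents i o (update n c (n c + 1))) := by
  simpa [← List.replicate_succ] using Runs.push (k := cnt c) (b := true) (s := contents i o n)

section LastBit

/-- Replaces the top bit of `out` by `b` and sets the flag `var`. -/
def overwrite (b : Bool) : StackProg Stack :=
  seq (seq (pop out) (push out b)) (push (cnt var) true)

/-- Copies one bit from the input to the output, where it replaces the top bit. -/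
def copyBit : StackProg Stack := case inp skip (overwrite false) (overwrite true)

/-- Reads the whole input and outputs its last bit. The flag `var` is set after every bit, so that
the loop ends at the end of the input. -/
def lastBit : StackProg Stack := seq (push (cnt var) true) (loop (cnt var) copyBit)

theorem runs_overwrite (b : Bool) (i o : List Bool) :
    (overwrite b).Runs (contents i o (counters 0 0 0)) 3
      (contents i (b :: o.tail) (counters 1 0 0)) := by
  have h₁ := runs_pop out (contents i o (counters 0 0 0))
  have h₃ := runs_push_cnt var i (b :: o.tail) (counters 0 0 0)
  rw [contents_out, update_contents_out] at h₁
  rw [update_counters_var] at h₃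
  exact (h₁.seq (runs_push_out b _ _ _)).seq h₃

theorem runs_copyBit (b : Bool) (i o : List Bool) :
    copyBit.Runs (contents (b :: i) o (counters 0 0 0)) 4
      (contents i (b :: o.tail) (counters 1 0 0)) := by
  have hb : contents (b :: i) o (counters 0 0 0) inp = b :: i := rfl
  have h := runs_overwrite b i o
  rw [← update_contents_inp (b :: i)] at h
  cases b
  · exact .case_false hb h
  · exact .case_true hb h

theorem runs_loop_copyBit (w : List Bool) (b : Bool) (o : List Bool) :
    (loop (cnt var) copyBit).Runs (contents (w ++ [b]) o (counters 1 0 0)) (5 * w.length + 8)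
      (contents [] (b :: o.tail) (counters 0 0 0)) := by
  have unset_flag (i o' : List Bool) : update (contents i o' (counters 1 0 0)) (cnt var) [] =
      contents i o' (counters 0 0 0) := by simp
  have flag (i o' : List Bool) : contents i o' (counters 1 0 0) (cnt var) = [true] := rfl
  have round (a : Bool) (i o' : List Bool) := runs_copyBit a i o'
  simp only [← unset_flag] at round
  induction w generalizing o with
  | nil =>
    have final : copyBit.Runs (contents [] (b :: o.tail) (counters 0 0 0)) 1
        (contents [] (b :: o.tail) (counters 0 0 0)) := .case_nil rfl .skip
    rw [← unset_flag [] (b :: o.tail)] at final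
    have h := Runs.loop_true (flag _ _) (round b [] o) (.loop_true (flag _ _) final (.loop_nil rfl))
    rwa [unset_flag] at h
  | cons a w ih =>
    refine (Runs.loop_true (flag _ _) (round a (w ++ [b]) o) (ih _)).mono ?_
    simp only [List.length_cons]
    lia

theorem runs_lastBit (w : List Bool) (b : Bool) :
    lastBit.Runs (update (fun _ => []) inp (w ++ [b])) (5 * w.length + 9)
      (update (fun _ => []) out [b]) := by
  rw [update_nil_inp, update_nil_out]
  have h := runs_push_cnt var (w ++ [b]) [] (counters 0 0 0)
  rw [update_counters_var] at h
  exact (h.seq (runs_loop_copyBit w b [])).mono (by lia)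

end LastBit

/-- Started on the input and the counter values `c`, the program `p` appends `w` to the output and
ends on the input and the counter values `c'` after at most `t` steps. Since the output is a stack,
it holds the last bit on top. -/
def Emits (p : StackProg Stack) (c : List Bool × (Counter → ℕ)) (w : List Bool) (t : ℕ)
    (c' : List Bool × (Counter → ℕ)) : Prop :=
  ∀ o, p.Runs (contents c.1 o c.2) t (contents c'.1 (w.reverse ++ o) c'.2)

/-- Appends `w` to the output. -/
def emit (w : List Bool) : StackProg Stack := w.foldr (fun b p => seq (push out b) p) skip

/-- Runs the programs of a list one after another. -/
def seqAll {K : Type} (l : List (StackProg K)) : StackProg K := l.foldr seq skip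

/-- Moves the counter `a` to the counter `b`, running `p` once per unit. -/
def move (a b : Counter) (p : StackProg Stack) : StackProg Stack :=
  loop (cnt a) (seq p (push (cnt b) true))

/-- Appends `k * n` times the bit `x` to the output, where `n` is the value of the counter `a`. -/
def emitMul (a : Counter) (k : ℕ) (x : Bool) : StackProg Stack :=
  seq (move a tmp (emit (List.replicate k x))) (move tmp a skip)

/-- Runs `p` for every variable of the formula. -/
def forEachVar (p : StackProg Stack) : StackProg Stack :=
  seq (move rest var p) (move var rest skip)

theorem Emits.mono {p c w t c' u} (h : Emits p c w t c') (htu : t ≤ u) : Emits p c w u c' :=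
  fun o => (h o).mono htu

theorem Emits.seq {p q c w t c' w' u c''} (hp : Emits p c w t c') (hq : Emits q c' w' u c'') :
    Emits (seq p q) c (w ++ w') (t + u) c'' := fun o => by
  simpa using (hp o).seq (hq _)

theorem emits_skip (c) : Emits skip c [] 0 c := fun _ => .skip

theorem emits_emit (w : List Bool) (c) : Emits (emit w) c w w.length c := by
  induction w with
  | nil => exact emits_skip c
  | cons b w ih =>
    have h : Emits (push out b) c [b] 1 c := fun o => runs_push_out b _ _ _
    exact (h.seq ih).mono (by simp [add_comm])

theorem emits_seqAll_map {α : Type} (l : List α) {p : α → StackProg Stack} {w : α → List Bool}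
    {c t} (h : ∀ a ∈ l, Emits (p a) c (w a) t c) :
    Emits (seqAll (l.map p)) c (l.flatMap w) (l.length * t) c := by
  induction l with
  | nil => exact (emits_skip c).mono (by simp)
  | cons a l ih =>
    rw [List.forall_mem_cons] at h
    exact (h.1.seq (ih h.2)).mono (by simp; lia)

theorem emits_push_cnt (b : Counter) (i : List Bool) (n : Counter → ℕ) :
    Emits (push (cnt b) true) (i, n) [] 1 (i, update n b (n b + 1)) :=
  fun o => runs_push_cnt b i o n

theorem emits_loop_nil {a : Counter} {n : Counter → ℕ} (h : n a = 0) (i : List Bool)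
    (p : StackProg Stack) : Emits (loop (cnt a) p) (i, n) [] 1 (i, n) :=
  fun o => .loop_nil (by simp [h])

theorem Emits.loop_succ {a : Counter} {n : Counter → ℕ} {x : ℕ} {i : List Bool}
    {p : StackProg Stack} {w w' t u c c'} (h : n a = x + 1)
    (hp : Emits p (i, update n a x) w t c) (hl : Emits (loop (cnt a) p) c w' u c') :
    Emits (loop (cnt a) p) (i, n) (w ++ w') (1 + t + u) c' := fun o => by
  have hp' := hp o
  rw [← update_contents_cnt] at hp'
  simpa using Runs.loop_true (by simp [h, List.replicate_succ]) hp' (hl _)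

theorem emits_move {a b : Counter} (hab : a ≠ b) {i : List Bool} {n : Counter → ℕ}
    {p : StackProg Stack} {w : ℕ → List Bool} {t x y : ℕ}
    (hp : ∀ x' y', x' + y' + 1 = x + y →
      Emits p (i, update (update n a x') b y') (w y') t (i, update (update n a x') b y')) :
    Emits (move a b p) (i, update (update n a x) b y) ((List.range' y x).flatMap w)
      (x * (t + 2) + 1) (i, update (update n a 0) b (x + y)) := by
  unfold move
  induction x generalizing y with
  | zero => simpa using emits_loop_nil (by simp [hab]) i _
  | succ x ih =>
    have take_a : update (update (update n a (x + 1)) b y) a x = update (update n a x) b y := by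
      rw [update_comm hab.symm, update_idem]
    have round := (hp x y (by lia)).seq (emits_push_cnt b i (update (update n a x) b y))
    rw [update_self, update_idem, ← take_a] at round
    have next := ih (y := y + 1) fun x' y' h => hp x' y' (by lia)
    have h := Emits.loop_succ (by simp [hab]) round next
    rw [List.append_nil, ← List.flatMap_cons, ← List.range'_succ,
      show x + (y + 1) = x + 1 + y by lia] at h
    exact h.mono (by lia)

theorem emits_emitMul {a : Counter} {n : Counter → ℕ} (ha : a ≠ tmp) (hn : n tmp = 0) (k : ℕ)
    (x : Bool) (i : List Bool) :
    Emits (emitMul a k x) (i, n) (List.replicate (k * n a) x) (n a * (k + 4) + 2) (i, n) := by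
  have start : update (update n a (n a)) tmp 0 = n := by
    rw [update_eq_self, ← hn, update_eq_self]
  have there := emits_move ha (i := i) (n := n) (x := n a) (y := 0)
    fun _ _ _ => emits_emit (List.replicate k x) _
  have back := emits_move ha.symm (i := i) (n := n) (x := n a) (y := 0)
    fun _ _ _ => emits_skip _
  rw [start, add_zero] at there
  rw [update_comm ha.symm, update_comm ha.symm, add_zero, start] at back
  have h := there.seq back
  simp only [List.flatMap_def, List.map_const', List.length_range',
    List.length_replicate, List.flatten_replicate_replicate, List.flatten_replicate_nil,
    List.append_nil] at h
  rw [mul_comm k]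
  exact h.mono (by lia)

theorem emits_rewind (v r : ℕ) (i : List Bool) :
    Emits (move var rest skip) (i, counters v r 0) [] (v * 2 + 1) (i, counters 0 (r + v) 0) := by
  simpa [List.flatMap_def, add_comm v] using emits_move (a := var) (b := rest)
    (n := counters 0 0 0) (x := v) (y := r) (by decide) fun _ _ _ => emits_skip _

theorem emits_forEachVar {p : StackProg Stack} {i : List Bool} {n t : ℕ} {w : ℕ → List Bool}
    (hp : ∀ v r, v + r + 1 = n → Emits p (i, counters v r 0) (w v) t (i, counters v r 0)) :
    Emits (forEachVar p) (i, counters 0 n 0) ((List.range n).flatMap w) (n * (t + 4) + 2)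
      (i, counters 0 n 0) := by
  have there : Emits (move rest var p) (i, counters 0 n 0) ((List.range' 0 n).flatMap w)
      (n * (t + 2) + 1) (i, counters n 0 0) := by
    simpa using emits_move (a := rest) (b := var) (n := counters 0 0 0) (x := n) (y := 0)
      (by decide) fun r v h => by simpa using hp v r (by lia)
  rw [← List.append_nil (List.flatMap w _), List.range_eq_range']
  have back := emits_rewind n 0 i
  rw [zero_add] at back
  exact (there.seq back).mono (by lia)

theorem emits_loop_encNat {p : StackProg Stack} {N : ℕ → Counter → ℕ} {t : ℕ} (k : ℕ)
    (i : List Bool) (hp : ∀ j i', Emits p (i', N j) [] t (i', N (j + 1))) :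
    Emits (loop inp p) (encNat k ++ i, N 0) [] (k * (t + 1) + 1) (i, N k) := fun o => by
  induction k generalizing N o with
  | zero =>
    have h := Runs.loop_false (p := p) (s := contents (encNat 0 ++ i) o (N 0)) (k := inp) rfl
    rw [update_contents_inp] at h
    exact h.mono (by simp)
  | succ k ih =>
    have round := hp 0 (encNat k ++ i) o
    rw [← update_contents_inp (encNat (k + 1) ++ i)] at round
    have rounds := ih (N := fun j => N (j + 1)) (fun j => hp (j + 1)) o
    have h := Runs.loop_true (k := inp) rfl round rounds
    exact h.mono (by lia)

theorem emits_loop_encList {α : Type} {enc w : α → List Bool} {p : StackProg Stack}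
    {n : Counter → ℕ} {t : ℕ} (l : List α) (i : List Bool)
    (hp : ∀ a ∈ l, ∀ i', Emits p (enc a ++ i', n) (w a) t (i', n)) :
    Emits (loop inp p) (encList enc l ++ i, n) (l.flatMap w) (l.length * (t + 1) + 1)
      (i, n) := fun o => by
  induction l generalizing o with
  | nil =>
    have h := Runs.loop_false (p := p) (s := contents (encList enc [] ++ i) o n) (k := inp) rfl
    rw [update_contents_inp] at h
    exact h.mono (by simp)
  | cons a l ih =>
    rw [List.forall_mem_cons] at hp
    have round := hp.1 (encList enc l ++ i) o
    have split : encList enc (a :: l) ++ i = true :: (enc a ++ (encList enc l ++ i)) := by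
      simp [encList]
    rw [← update_contents_inp (encList enc (a :: l) ++ i)] at round
    have h := (Runs.loop_true (by simpa using split) round (ih hp.2 _)).mono
      (u := (l.length + 1) * (t + 1) + 1) (by lia)
    simpa using h

end StackProg

namespace SolvableWithin

variable {α : Type} {encode : α → List Bool} {correct : α → List Bool → Prop} {time : α → ℝ}

theorem mono {time' : α → ℝ} (h : SolvableWithin encode correct time)
    (hle : ∀ a, time a ≤ time' a) : SolvableWithin encode correct time' := by
  obtain ⟨M, hM⟩ := h
  refine ⟨M, fun a => ?_⟩
  obtain ⟨out, t, hout, ht, hMt⟩ := hM a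
  exact ⟨out, t, hout, ht.trans (hle a), hMt⟩

theorem of_reduction {β K : Type} [DecidableEq K] [Finite K] {encode' : β → List Bool}
    {f : β → α} {steps : β → ℕ} {p : StackProg K} {inp out : K} (hne : inp ≠ out)
    (hp : ∀ b, p.Runs (update (fun _ => []) inp (encode' b)) (steps b)
      (update (fun _ => []) out (encode (f b)).reverse))
    (h : SolvableWithin encode correct time) :
    SolvableWithin encode' (fun b => correct (f b)) fun b => 2 * steps b + 2 + time (f b) := by
  obtain ⟨M, hM⟩ := h
  have := Fintype.ofFinite K
  refine ⟨compReverse (p.toMachine inp out) M, fun b => ?_⟩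
  obtain ⟨y, t, hy, ht, hMt⟩ := hM (f b)
  refine ⟨y, _, hy, ?_, (hp b).computes.compReverse hMt⟩
  have length_le : ((encode (f b)).length : ℝ) ≤ steps b := by
    simpa [hne.symm] using (hp b).length_le out
  push_cast
  linarith

theorem head {correct' : α → List Bool → Prop} {len : α → ℕ}
    (h : SolvableWithin encode correct time)
    (hcorrect : ∀ a out, correct a out →
      ∃ b z, out = b :: z ∧ z.length ≤ len a ∧ correct' a [b]) :
    SolvableWithin encode correct' fun a => time a + (6 * len a + 12) := by
  obtain ⟨M, hM⟩ := h
  refine ⟨compReverse M (StackProg.lastBit.toMachine inp out), fun a => ?_⟩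
  obtain ⟨y, t, hy, ht, hMt⟩ := hM a
  obtain ⟨b, z, rfl, hz, hb⟩ := hcorrect a y hy
  have reverse_eq : b :: z = (z.reverse ++ [b]).reverse := by simp
  rw [reverse_eq] at hMt
  refine ⟨[b], _, hb, ?_, Computes.compReverse hMt (StackProg.runs_lastBit _ b).computes⟩
  have hz' : (z.length : ℝ) ≤ len a := by exact_mod_cast hz
  simp only [List.length_append, List.length_reverse, List.length_singleton]
  push_cast
  linarith

end SolvableWithin

/-! ### The workflow of a formula -/

namespace CNF3

variable {n : ℕ}

/-- The number of steps of the workflow of a formula with `n` variables: three copies of each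
literal, and one step whose user stands for the truth value `false`. Since the clauses of a formula
are triples, the positions in a clause have to be distinguished, as otherwise distinct clauses could
give the same constraint. -/
abbrev numSteps (n : ℕ) : ℕ := 3 * (n * 2) + 1

/-- The copy for position `p` of a literal. -/
def literalStep (p : Fin 3) (l : Literal n) : Fin (numSteps n) :=
  (finProdFinEquiv (p, finProdFinEquiv (l.1, finTwoEquiv.symm l.2))).castSucc

/-- The step whose user stands for the truth value `false`. -/
def falseStep : Fin (numSteps n) := Fin.last _

@[simp]
theorem literalStep_inj {p q : Fin 3} {l m : Literal n} :
    literalStep p l = literalStep q m ↔ p = q ∧ l = m := by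
  simp [literalStep, Prod.ext_iff]

@[simp]
theorem literalStep_ne_falseStep (p : Fin 3) (l : Literal n) : literalStep p l ≠ falseStep :=
  Fin.castSucc_ne_last _

/-- The constraint `(≠, S', S'')`. -/
def neConstraint {k m : ℕ} (S' S'' : Finset (Fin k)) : Entailment k m := ⟨(· != ·), S', S''⟩

theorem satisfiedBy_neConstraint {k m : ℕ} {S' S'' : Finset (Fin k)} {π : Fin k → Fin m} :
    (neConstraint S' S'').SatisfiedBy π ↔ ∃ s ∈ S', ∃ s' ∈ S'', π s ≠ π s' := by
  simp [neConstraint, Entailment.SatisfiedBy]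

/-- Copies of complementary literals are performed by different users. -/
def conflictConstraint (v : Fin n) (p q : Fin 3) : Entailment (numSteps n) 2 :=
  neConstraint {literalStep p (v, false)} {literalStep q (v, true)}

/-- Some literal of the clause is not performed by the user that stands for `false`. -/
def clauseConstraint (c : Clause n) : Entailment (numSteps n) 2 :=
  neConstraint {falseStep} (Finset.univ.image fun p => literalStep p (c p))

/-- All conflict constraints. -/
def conflictConstraints (n : ℕ) : List (Entailment (numSteps n) 2) :=
  (List.finRange n ×ˢ (List.finRange 3 ×ˢ List.finRange 3)).map
    fun x => conflictConstraint x.1 x.2.1 x.2.2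

theorem conflictConstraint_injective :
    Injective fun x : Fin n × Fin 3 × Fin 3 => conflictConstraint x.1 x.2.1 x.2.2 := by
  rintro ⟨v, p, q⟩ ⟨v', p', q'⟩ h
  simp_all [conflictConstraint, neConstraint]

theorem clauseConstraint_injective : Injective (clauseConstraint : Clause n → _) := by
  intro c d h
  have right_eq : Finset.univ.image (fun p => literalStep p (c p)) =
      Finset.univ.image fun p => literalStep p (d p) := congrArg Entailment.right h
  funext p
  have hp : literalStep p (c p) ∈ Finset.univ.image fun p => literalStep p (d p) :=
    right_eq ▸ Finset.mem_image_of_mem _ (Finset.mem_univ p)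
  simp_all

theorem conflictConstraint_ne_clauseConstraint (v : Fin n) (p q : Fin 3) (c : Clause n) :
    conflictConstraint v p q ≠ clauseConstraint c := fun h => by
  simpa [conflictConstraint, clauseConstraint, neConstraint] using congrArg Entailment.left h

theorem mem_conflictConstraints {γ : Entailment (numSteps n) 2} :
    γ ∈ conflictConstraints n ↔ ∃ v p q, conflictConstraint v p q = γ := by
  simp [conflictConstraints]

/-- The workflow of a formula: all users are authorized for all steps, and no step has to precede
another. -/
def toWorkflow (φ : CNF3) : Workflow where
  numSteps := numSteps φ.numVars
  numUsers := 2
  le s t := s == t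
  le_refl := by simp
  le_antisymm := by simp
  le_trans := by simp
  auth _ _ := true
  exists_auth _ := ⟨0, rfl⟩
  constraints := conflictConstraints φ.numVars ++ φ.clauses.map clauseConstraint
  nodup := by
    have nodup_conflicts : (conflictConstraints φ.numVars).Nodup :=
      (((List.nodup_finRange _).product
        ((List.nodup_finRange _).product (List.nodup_finRange _))).map
        conflictConstraint_injective)
    refine nodup_conflicts.append (φ.nodup.map clauseConstraint_injective) fun γ h h' => ?_
    obtain ⟨v, p, q, rfl⟩ := mem_conflictConstraints.1 h
    obtain ⟨c, -, hc⟩ := List.mem_map.1 h'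
    exact conflictConstraint_ne_clauseConstraint v p q c hc.symm

theorem isTwoUserWSP2Ne_toWorkflow (φ : CNF3) : φ.toWorkflow.IsTwoUserWSP2Ne := by
  refine ⟨rfl, fun γ hγ => ?_⟩
  obtain h | h := List.mem_append.1 hγ
  · obtain ⟨v, p, q, rfl⟩ := mem_conflictConstraints.1 h
    exact ⟨fun u v => bne_iff_ne, .inl (Finset.card_singleton _)⟩
  · obtain ⟨c, -, rfl⟩ := List.mem_map.1 h
    exact ⟨fun u v => bne_iff_ne, .inl (Finset.card_singleton _)⟩

theorem valid_toWorkflow_iff {φ : CNF3} {π : Fin (numSteps φ.numVars) → Fin 2} :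
    φ.toWorkflow.Valid π ↔
      (∀ v p q, π (literalStep p (v, false)) ≠ π (literalStep q (v, true))) ∧
        ∀ c ∈ φ.clauses, ∃ p, π falseStep ≠ π (literalStep p (c p)) := by
  have forall_conflicts (P : Entailment (numSteps φ.numVars) 2 → Prop) :
      (∀ γ ∈ conflictConstraints φ.numVars, P γ) ↔ ∀ v p q, P (conflictConstraint v p q) := by
    simp only [mem_conflictConstraints]
    exact ⟨fun h v p q => h _ ⟨v, p, q, rfl⟩, by rintro h _ ⟨v, p, q, rfl⟩; exact h v p q⟩
  have valid_iff : φ.toWorkflow.Valid π ↔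
      ∀ γ ∈ conflictConstraints φ.numVars ++ φ.clauses.map clauseConstraint, γ.SatisfiedBy π :=
    ⟨fun h => h.2, fun h => ⟨fun _ => rfl, h⟩⟩
  rw [valid_iff, List.forall_mem_append, List.forall_mem_map, forall_conflicts]
  simp [conflictConstraint, clauseConstraint, satisfiedBy_neConstraint]

/-- The plan of a truth assignment. -/
def plan (τ : Fin n → Bool) : Fin (numSteps n) → Fin 2 :=
  Fin.lastCases 0 fun i =>
    let l := finProdFinEquiv.symm (finProdFinEquiv.symm i).2
    if τ l.1 = finTwoEquiv l.2 then 1 else 0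

theorem plan_falseStep (τ : Fin n → Bool) : plan τ falseStep = 0 := Fin.lastCases_last

theorem plan_literalStep (τ : Fin n → Bool) (p : Fin 3) (l : Literal n) :
    plan τ (literalStep p l) = if τ l.1 = l.2 then 1 else 0 := by
  simp [plan, literalStep, -finProdFinEquiv_symm_apply]

theorem exists_valid_toWorkflow_iff {φ : CNF3} :
    (∃ π, φ.toWorkflow.Valid π) ↔ φ.Satisfiable := by
  constructor
  · rintro ⟨(π : Fin (numSteps φ.numVars) → Fin 2), hπ⟩
    obtain ⟨conflicts, clauses⟩ := valid_toWorkflow_iff.1 hπ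
    refine ⟨fun v => decide (π falseStep ≠ π (literalStep 0 (v, true))), fun c hc => ?_⟩
    obtain ⟨p, hp⟩ := clauses c hc
    refine ⟨p, ?_⟩
    generalize c p = l at hp ⊢
    obtain ⟨v, b⟩ := l
    have h₁ := conflicts v p 0
    have h₂ := conflicts v 0 p
    have h₃ := conflicts v 0 0
    cases b <;> simp only [decide_eq_true_eq, decide_eq_false_iff_not] <;> omega
  · rintro ⟨τ, hτ⟩
    refine ⟨plan τ, valid_toWorkflow_iff.2 ⟨fun v p q => ?_, fun c hc => ?_⟩⟩
    · rw [plan_literalStep, plan_literalStep]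
      cases τ v <;> simp
    · obtain ⟨p, hp⟩ := hτ c hc
      exact ⟨p, by simp [plan_falseStep, plan_literalStep, hp]⟩

theorem length_plan_le {k : ℕ} (π : Fin k → Fin 2) :
    (List.ofFn fun s => encNat (π s)).flatten.length ≤ 2 * k := by
  have length_le (s : Fin k) : (encNat (π s)).length ≤ 2 := by
    simp [encNat]
    lia
  rw [List.length_flatten, List.map_ofFn, List.sum_ofFn]
  exact (Finset.sum_le_card_nsmul _ _ 2 fun s _ => length_le s).trans (by simp [mul_comm])

theorem exists_head_of_correct_toWorkflow (φ : CNF3) (out : List Bool)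
    (h : φ.toWorkflow.Correct out) :
    ∃ b z, out = b :: z ∧ z.length ≤ 2 * numSteps φ.numVars ∧ φ.Correct [b] := by
  rw [Workflow.Correct, exists_valid_toWorkflow_iff] at h
  obtain ⟨π, hπ, rfl⟩ | ⟨hφ, rfl⟩ := h
  · exact ⟨true, _, rfl, length_plan_le π, .inl ⟨exists_valid_toWorkflow_iff.1 ⟨π, hπ⟩, rfl⟩⟩
  · exact ⟨false, [], rfl, by simp, .inr ⟨hφ, rfl⟩⟩

end CNF3

/-! ### The code of the workflow -/

theorem ofFn_finProdFinEquiv {α : Type} {m n : ℕ} (f : Fin (m * n) → α) :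
    List.ofFn f =
      (List.finRange m).flatMap fun i => List.ofFn fun j => f (finProdFinEquiv (i, j)) := by
  rw [List.ofFn_mul, List.flatMap_def, ← List.ofFn_eq_map]
  congr! 6
  simp [Fin.ext_iff, add_comm, mul_comm]

theorem flatMap_finRange {α : Type} (n : ℕ) (f : ℕ → List α) :
    ((List.finRange n).flatMap fun v : Fin n => f v) = (List.range n).flatMap f := by
  rw [← List.map_coe_finRange_eq_range, List.flatMap_map]

theorem flatMap_eq_replicate {α β : Type} {l : List α} {f : α → List β} {k m : ℕ} {x : β}
    (h : ∀ a ∈ l, f a = List.replicate k x) (hm : l.length * k = m) :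
    l.flatMap f = List.replicate m x := by
  rw [List.flatMap_def, List.map_congr_left h, List.map_const', List.flatten_replicate_replicate,
    hm]

namespace CNF3

/-- The bits of the entries of a vector that belong to the copies of the literals for one position,
with `x` at the place of the two literals of the variable `v` and zeros elsewhere. -/
def block (n v : ℕ) (x : List Bool) : List Bool :=
  List.replicate (2 * v) false ++ x ++ List.replicate (2 * (n - 1 - v)) false

/-- The code of `{literalStep p (v, b)}`. -/
def singletonBits (n v : ℕ) (p : Fin 3) (b : Bool) : List Bool :=
  ((List.finRange 3).flatMap fun q => block n v (if q = p then [!b, b] else [false, false])) ++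
    [false]

/-- The code of `{falseStep}`. -/
def falseStepBits (n : ℕ) : List Bool := List.replicate (6 * n) false ++ [true]

/-- The code of the equality of steps. -/
def equalityBits (n : ℕ) : List Bool :=
  ((List.finRange 3).flatMap fun p => (List.range n).flatMap fun v =>
    singletonBits n v p false ++ singletonBits n v p true) ++ falseStepBits n

/-- The entry of `conflictConstraint v p q` in the list of constraints. -/
def conflictBits (n v : ℕ) (p q : Fin 3) : List Bool :=
  [true, false, true, true, false] ++ singletonBits n v p false ++ singletonBits n v q true

/-- The entry of `clauseConstraint c` in the list of constraints. -/
def clauseBits {n : ℕ} (c : Clause n) : List Bool :=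
  [true, false, true, true, false] ++ falseStepBits n ++
    ((List.finRange 3).flatMap fun p => block n (c p).1 [!(c p).2, (c p).2]) ++ [false]

variable {n : ℕ}

theorem ofFn_numSteps {α : Type} (f : Fin (numSteps n) → α) :
    List.ofFn f = ((List.finRange 3).flatMap fun p => (List.finRange n).flatMap fun v =>
      [f (literalStep p (v, false)), f (literalStep p (v, true))]) ++ [f falseStep] := by
  rw [List.ofFn_succ_last, ofFn_finProdFinEquiv]
  simp only [ofFn_finProdFinEquiv, List.ofFn_succ, List.ofFn_zero]
  rfl

theorem flatMap_ite_eq_block (v : Fin n) (x : List Bool) :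
    ((List.finRange n).flatMap fun w => if w = v then x else [false, false]) = block n v x := by
  have split : List.range n = List.range v ++ (v : ℕ) :: List.range' (v + 1) (n - 1 - v) := by
    rw [← List.range'_succ, List.range_eq_range', List.range_eq_range',
      show List.range' v _ = List.range' (0 + v) _ by rw [zero_add], List.range'_append_1]
    congr 1
    lia
  have before : ((List.range v).flatMap fun w : ℕ => if w = v then x else [false, false]) =
      List.replicate (2 * v) false := by
    refine flatMap_eq_replicate (k := 2) (fun w hw => if_neg (List.mem_range.1 hw).ne) ?_
    rw [List.length_range, mul_comm]
  have after : ((List.range' (v + 1) (n - 1 - v)).flatMap fun w : ℕ =>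
      if w = v then x else [false, false]) = List.replicate (2 * (n - 1 - v)) false := by
    refine flatMap_eq_replicate (k := 2) (fun w hw => if_neg ?_) ?_
    · have := List.mem_range'_1.1 hw
      lia
    · rw [List.length_range', mul_comm]
  simp only [Fin.ext_iff]
  rw [flatMap_finRange n fun w : ℕ => if w = v then x else [false, false], split,
    List.flatMap_append, List.flatMap_cons, before, after, if_pos rfl, block, List.append_assoc]

theorem encSet_singleton_literalStep (p : Fin 3) (v : Fin n) (b : Bool) :
    encSet {literalStep p (v, b)} = singletonBits n v p b := by
  simp only [encSet, ofFn_numSteps, singletonBits, ← flatMap_ite_eq_block]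
  congr 1
  · refine List.flatMap_congr fun q _ => List.flatMap_congr fun w _ => ?_
    obtain rfl | hq := eq_or_ne q p <;> obtain rfl | hw := eq_or_ne w v <;> cases b <;> simp [*]
  · simp [(literalStep_ne_falseStep _ _).symm]

theorem encSet_image_literalStep (c : Clause n) :
    encSet (Finset.univ.image fun p => literalStep p (c p)) =
      ((List.finRange 3).flatMap fun p => block n (c p).1 [!(c p).2, (c p).2]) ++ [false] := by
  simp only [encSet, ofFn_numSteps, ← flatMap_ite_eq_block]
  congr 1
  · refine List.flatMap_congr fun q _ => List.flatMap_congr fun w _ => ?_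
    have mem_image (l : Literal n) :
        literalStep q l ∈ Finset.univ.image (fun p => literalStep p (c p)) ↔ c q = l := by simp
    simp only [mem_image]
    obtain ⟨u, b⟩ := c q
    obtain rfl | hw := eq_or_ne u w
    · cases b <;> simp
    · simp [hw, hw.symm]
  · simp

theorem encSet_singleton_falseStep : encSet {(falseStep : Fin (numSteps n))} = falseStepBits n := by
  rw [encSet, ofFn_numSteps, falseStepBits]
  congr 1
  · refine flatMap_eq_replicate (k := n * 2) (fun p _ => ?_) (by simp; lia)
    exact flatMap_eq_replicate (k := 2) (fun v _ => by simp) (by simp)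
  · simp

theorem encMatrix_ne : encMatrix (fun u v : Fin 2 => u != v) = [false, true, true, false] := rfl

theorem encode_conflictConstraint (v : Fin n) (p q : Fin 3) :
    true :: (conflictConstraint v p q).encode = conflictBits n v p q := by
  simp only [Entailment.encode, conflictConstraint, neConstraint, encMatrix_ne,
    encSet_singleton_literalStep]
  rfl

theorem encode_clauseConstraint (c : Clause n) :
    true :: (clauseConstraint c).encode = clauseBits c := by
  simp only [Entailment.encode, clauseConstraint, neConstraint, encMatrix_ne,
    encSet_singleton_falseStep, encSet_image_literalStep]
  simp [clauseBits]

theorem encMatrix_eq : encMatrix (fun s t : Fin (numSteps n) => s == t) = equalityBits n := by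
  have row (s : Fin (numSteps n)) : (List.ofFn fun t => s == t) = encSet {s} := by
    simp [encSet, beq_eq_decide, eq_comm]
  simp only [encMatrix, row, ofFn_numSteps, encSet_singleton_literalStep,
    encSet_singleton_falseStep, equalityBits, ← flatMap_finRange, ← List.flatMap_id,
    List.flatMap_append, List.flatMap_assoc]
  simp

theorem encMatrix_true {p q : ℕ} :
    encMatrix (fun (_ : Fin p) (_ : Fin q) => true) = List.replicate (p * q) true := by
  simp [encMatrix, List.ofFn_const, List.flatten_replicate_replicate]

theorem encList_constraints (φ : CNF3) :
    encList Entailment.encode (conflictConstraints φ.numVars ++ φ.clauses.map clauseConstraint) =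
      ((List.range φ.numVars).flatMap fun v => (List.finRange 3 ×ˢ List.finRange 3).flatMap
        fun x => conflictBits φ.numVars v x.1 x.2) ++ φ.clauses.flatMap clauseBits ++ [false] := by
  have product_eq : List.finRange φ.numVars ×ˢ (List.finRange 3 ×ˢ List.finRange 3) =
      (List.finRange φ.numVars).flatMap fun v =>
        (List.finRange 3 ×ˢ List.finRange 3).map (Prod.mk v) := rfl
  simp only [encList, conflictConstraints, product_eq, List.flatMap_append, List.flatMap_map,
    List.flatMap_assoc, encode_conflictConstraint, encode_clauseConstraint, ← flatMap_finRange]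

theorem encode_toWorkflow (φ : CNF3) :
    φ.toWorkflow.encode =
      List.replicate (6 * φ.numVars) true ++ [true, false, true, true, false] ++
      equalityBits φ.numVars ++ List.replicate (12 * φ.numVars) true ++ [true, true] ++
      ((List.range φ.numVars).flatMap fun v => (List.finRange 3 ×ˢ List.finRange 3).flatMap
        fun x => conflictBits φ.numVars v x.1 x.2) ++
      φ.clauses.flatMap clauseBits ++ [false] := by
  have auth_eq : List.replicate (numSteps φ.numVars * 2) true =
      List.replicate (12 * φ.numVars) true ++ [true, true] := by
    rw [show [true, true] = List.replicate 2 true from rfl, List.replicate_append_replicate]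
    congr 1
    lia
  have numSteps_eq : List.replicate (numSteps φ.numVars) true =
      List.replicate (6 * φ.numVars) true ++ [true] := by
    rw [← List.replicate_succ']
    congr 1
    lia
  simp only [Workflow.encode, toWorkflow, encNat, encMatrix_eq, encMatrix_true, numSteps_eq,
    auth_eq, encList_constraints]
  simp

end CNF3

/-! ### Programs that write the workflow -/

namespace StackProg

open CNF3

/-- Appends a block for the variable with index `var`, if there are `rest` later variables. -/
def blockProg (x : List Bool) : StackProg Stack :=
  seq (emitMul var 2 false) (seq (emit x) (emitMul rest 2 false))

/-- Appends `singletonBits`. -/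
def singletonProg (p : Fin 3) (b : Bool) : StackProg Stack :=
  seq (seqAll ((List.finRange 3).map fun q =>
    blockProg (if q = p then [!b, b] else [false, false]))) (emit [false])

/-- Appends `falseStepBits`. -/
def falseStepProg : StackProg Stack := seq (emitMul rest 6 false) (emit [true])

/-- Appends `equalityBits`. -/
def equalityProg : StackProg Stack :=
  seq (seqAll ((List.finRange 3).map fun p =>
    forEachVar (seq (singletonProg p false) (singletonProg p true)))) falseStepProg

/-- Appends `conflictBits`. -/
def conflictProg (p q : Fin 3) : StackProg Stack :=
  seq (seq (emit [true, false, true, true, false]) (singletonProg p false)) (singletonProg q true)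

/-- Appends the conflict constraints. -/
def conflictsProg : StackProg Stack :=
  forEachVar (seqAll ((List.finRange 3 ×ˢ List.finRange 3).map fun x => conflictProg x.1 x.2))

/-- Reads a literal and appends its block. -/
def literalProg : StackProg Stack :=
  seqAll [loop inp (seq (pop (cnt rest)) (push (cnt var) true)), pop (cnt rest),
    case inp skip (blockProg [true, false]) (blockProg [false, true]),
    push (cnt rest) true, move var rest skip]

/-- Reads a clause and appends `clauseBits`. -/
def clauseProg : StackProg Stack :=
  seqAll [emit [true, false, true, true, false], falseStepProg, literalProg, literalProg,
    literalProg, emit [false]]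

/-- Reads a formula and outputs its workflow. -/
def workflowProg : StackProg Stack :=
  seqAll [loop inp (push (cnt rest) true),
    emitMul rest 6 true, emit [true, false, true, true, false], equalityProg,
    emitMul rest 12 true, emit [true, true], conflictsProg, loop inp clauseProg, emit [false],
    loop (cnt rest) skip]

section Emits

variable {n v r : ℕ} {i : List Bool}

theorem emits_blockProg (h : v + r + 1 = n) (x : List Bool) :
    Emits (blockProg x) (i, counters v r 0) (block n v x) (6 * n + x.length)
      (i, counters v r 0) := by
  have before := emits_emitMul (a := var) (n := counters v r 0) (by decide) rfl 2 false i
  have after := emits_emitMul (a := rest) (n := counters v r 0) (by decide) rfl 2 false i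
  have hr : n - 1 - v = r := by lia
  rw [block, hr, List.append_assoc]
  refine (before.seq ((emits_emit x _).seq after)).mono ?_
  simp only [counters]
  lia

theorem emits_singletonProg (h : v + r + 1 = n) (p : Fin 3) (b : Bool) :
    Emits (singletonProg p b) (i, counters v r 0) (singletonBits n v p b) (18 * n + 7)
      (i, counters v r 0) := by
  have blocks := emits_seqAll_map (List.finRange 3) fun q _ =>
    (emits_blockProg (i := i) h (if q = p then [!b, b] else [false, false])).mono
      (u := 6 * n + 2) (by split_ifs <;> rfl)
  refine (blocks.seq (emits_emit [false] _)).mono ?_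
  simp only [List.length_finRange, List.length_singleton]
  lia

theorem emits_falseStepProg (n : ℕ) (i : List Bool) :
    Emits falseStepProg (i, counters 0 n 0) (falseStepBits n) (10 * n + 3)
      (i, counters 0 n 0) := by
  have zeros := emits_emitMul (a := rest) (n := counters 0 n 0) (by decide) rfl 6 false i
  refine (zeros.seq (emits_emit [true] _)).mono ?_
  simp only [counters, List.length_singleton]
  lia

theorem emits_equalityProg (n : ℕ) (i : List Bool) :
    Emits equalityProg (i, counters 0 n 0) (equalityBits n) (108 * n ^ 2 + 64 * n + 9)
      (i, counters 0 n 0) := by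
  have rows (p : Fin 3) := emits_forEachVar (i := i) (n := n) fun v r h =>
    (emits_singletonProg h p false).seq (emits_singletonProg h p true)
  refine ((emits_seqAll_map (List.finRange 3) fun p _ => rows p).seq
    (emits_falseStepProg n i)).mono ?_
  rw [List.length_finRange]
  ring_nf
  rfl

theorem emits_conflictProg (h : v + r + 1 = n) (p q : Fin 3) :
    Emits (conflictProg p q) (i, counters v r 0) (conflictBits n v p q) (36 * n + 19)
      (i, counters v r 0) := by
  refine (((emits_emit _ _).seq (emits_singletonProg h p false)).seq
    (emits_singletonProg h q true)).mono ?_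
  simp only [List.length_cons, List.length_nil]
  lia

theorem emits_conflictsProg (n : ℕ) (i : List Bool) :
    Emits conflictsProg (i, counters 0 n 0)
      ((List.range n).flatMap fun v => (List.finRange 3 ×ˢ List.finRange 3).flatMap
        fun x => conflictBits n v x.1 x.2)
      (324 * n ^ 2 + 175 * n + 2) (i, counters 0 n 0) := by
  refine (emits_forEachVar fun v r h => emits_seqAll_map (List.finRange 3 ×ˢ List.finRange 3)
    fun x _ => emits_conflictProg h x.1 x.2).mono ?_
  rw [List.length_product, List.length_finRange]
  ring_nf
  rfl

theorem emits_pop_cnt (c : Counter) (i : List Bool) (m : Counter → ℕ) :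
    Emits (pop (cnt c)) (i, m) [] 1 (i, update m c (m c - 1)) := fun o => by
  simpa using runs_pop (cnt c) (contents i o m)

theorem emits_case_inp {q₀ q₁ : StackProg Stack} {m c w t} (b : Bool)
    (h : Emits (if b then q₁ else q₀) (i, m) w t c) :
    Emits (case inp skip q₀ q₁) (b :: i, m) w (1 + t) c := fun o => by
  have h := h o
  rw [← update_contents_inp (b :: i)] at h
  cases b
  · exact .case_false rfl h
  · exact .case_true rfl h

theorem emits_literalProg (v : Fin n) (b : Bool) (i : List Bool) :
    Emits literalProg (encNat v ++ [b] ++ i, counters 0 n 0) (block n v [!b, b]) (11 * n + 7)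
      (i, counters 0 n 0) := by
  have seek := emits_loop_encNat (N := fun j => counters j (n - j) 0) v ([b] ++ i)
    fun j i' => by
      simpa [counters, Nat.sub_sub] using
        (emits_pop_cnt rest i' (counters j (n - j) 0)).seq (emits_push_cnt var i' _)
  have skip_var := emits_pop_cnt rest ([b] ++ i) (counters v (n - v) 0)
  have write (x : List Bool) := emits_blockProg (n := n) (v := v) (r := n - v - 1) (i := i)
    (by lia) x
  have read_sign := emits_case_inp b (i := i) (t := 6 * n + 2) (q₀ := blockProg [true, false])
    (q₁ := blockProg [false, true]) (w := block n v [!b, b]) (by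
      cases b
      exacts [write [true, false], write [false, true]])
  have unskip_var := emits_push_cnt rest i (counters v (n - v - 1) 0)
  have rewind := emits_rewind v (n - v) i
  rw [update_counters_rest] at skip_var unskip_var
  have h₁ : counters v (n - v) 0 rest - 1 = n - v - 1 := rfl
  have h₂ : counters v (n - v - 1) 0 rest + 1 = n - v := by simp only [counters]; lia
  rw [h₁] at skip_var
  rw [h₂] at unskip_var
  rw [show n - v + v = n by lia] at rewind
  rw [List.append_assoc, ← List.append_nil (block _ _ _)]
  refine (seek.seq (skip_var.seq (read_sign.seq (unskip_var.seq
    (rewind.seq (emits_skip _)))))).mono ?_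
  lia

theorem emits_clauseProg (c : Clause n) (i : List Bool) :
    Emits clauseProg ((List.ofFn fun p => encNat (c p).1 ++ [(c p).2]).flatten ++ i,
      counters 0 n 0) (clauseBits c) (43 * n + 30) (i, counters 0 n 0) := by
  have literal (p : Fin 3) := emits_literalProg (c p).1 (c p).2
  have h := (emits_emit [true, false, true, true, false] _).seq ((emits_falseStepProg n _).seq
    ((literal 0 _).seq ((literal 1 _).seq ((literal 2 _).seq
      ((emits_emit [false] (i, counters 0 n 0)).seq (emits_skip _))))))
  have h := h.mono (u := 43 * n + 30) (by simp; lia)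
  simpa [List.ofFn_succ, clauseBits, clauseProg, seqAll, List.finRange_succ] using h

theorem emits_drain (c : Counter) (i : List Bool) (m : Counter → ℕ) :
    Emits (loop (cnt c) skip) (i, m) [] (m c + 1) (i, update m c 0) := by
  induction h : m c generalizing m with
  | zero =>
    rw [← h, update_eq_self]
    exact (emits_loop_nil h i skip).mono (by lia)
  | succ x ih =>
    have rest := ih (update m c x) (by simp)
    rw [update_idem] at rest
    exact (Emits.loop_succ h (emits_skip _) rest).mono (by lia)

end Emits

end StackProg

namespace CNF3

theorem length_clauses_le (φ : CNF3) : φ.clauses.length ≤ (2 * φ.numVars) ^ 3 := by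
  simpa [mul_comm] using φ.nodup.length_le_card

end CNF3

namespace StackProg

open CNF3

theorem emits_workflowProg (φ : CNF3) :
    Emits workflowProg (φ.encode, counters 0 0 0) φ.toWorkflow.encode
      (400 * (φ.numVars + 1) ^ 4) ([], counters 0 0 0) := by
  set n := φ.numVars
  have read_numVars (i : List Bool) := emits_loop_encNat (N := fun j => counters 0 j 0) n i
    fun j i' => by simpa [counters] using emits_push_cnt rest i' (counters 0 j 0)
  have ones (k : ℕ) (i : List Bool) :=
    emits_emitMul (a := rest) (n := counters 0 n 0) (by decide) rfl k true i
  have clauses := emits_loop_encList φ.clauses [] fun c _ i => emits_clauseProg c i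
  have drain := emits_drain rest [] (counters 0 n 0)
  rw [update_counters_rest] at drain
  have h := (read_numVars _).seq ((ones 6 _).seq
    ((emits_emit [true, false, true, true, false] _).seq ((emits_equalityProg n _).seq
      ((ones 12 _).seq ((emits_emit [true, true] _).seq ((emits_conflictsProg n _).seq
        (clauses.seq ((emits_emit [false] _).seq (drain.seq (emits_skip _))))))))))
  rw [encode_toWorkflow]
  have h := h.mono (u := 400 * (n + 1) ^ 4) (by
    have count : φ.clauses.length * (43 * n + 30 + 1) ≤ (2 * n) ^ 3 * (43 * n + 30 + 1) :=
      Nat.mul_le_mul_right _ φ.length_clauses_le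
    simp only [counters, List.length_cons, List.length_nil]
    ring_nf at count ⊢
    lia)
  simpa [workflowProg, seqAll, CNF3.encode, counters] using h

theorem runs_workflowProg (φ : CNF3) :
    workflowProg.Runs (update (fun _ => []) inp φ.encode) (400 * (φ.numVars + 1) ^ 4)
      (update (fun _ => []) out φ.toWorkflow.encode.reverse) := by
  rw [update_nil_inp, update_nil_out]
  simpa using emits_workflowProg φ []

end StackProg

/-! ### The lower bound -/

theorem CNF3.length_encode_toWorkflow_le (φ : CNF3) :
    φ.toWorkflow.encode.length ≤ 400 * (φ.numVars + 1) ^ 4 := by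
  simpa using (StackProg.runs_workflowProg φ).length_le out

theorem TwoUserWSP2NeSolvableWithin.solvableWithin_cnf3 {time : Workflow → ℝ}
    (h : TwoUserWSP2NeSolvableWithin time) :
    SolvableWithin CNF3.encode CNF3.Correct fun φ =>
      886 * ((φ.numVars : ℝ) + 1) ^ 4 + time φ.toWorkflow := by
  have reduced := SolvableWithin.of_reduction
    (f := fun φ : CNF3 => ⟨φ.toWorkflow, φ.isTwoUserWSP2Ne_toWorkflow⟩)
    (by decide) StackProg.runs_workflowProg h
  have answered := reduced.head CNF3.exists_head_of_correct_toWorkflow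
  refine answered.mono fun φ => ?_
  have one_le : (1 : ℝ) ≤ φ.numVars + 1 := by simp
  have numVars_le : (φ.numVars : ℝ) + 1 ≤ (φ.numVars + 1) ^ 4 := le_self_pow₀ one_le (by lia)
  simp only [CNF3.numSteps]
  push_cast
  linarith

theorem exists_pow_mul_two_rpow_le {a b : ℝ} (hab : a < b) (D : ℕ) :
    ∃ B : ℝ, ∀ n : ℕ, (n + 1 : ℝ) ^ D * 2 ^ (a * n) ≤ B * 2 ^ (b * n) := by
  set c := (b - a) * Real.log 2
  have : 0 < c := mul_pos (sub_pos.2 hab) (Real.log_pos one_lt_two)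
  refine ⟨D.factorial / c ^ D * Real.exp c, fun n => ?_⟩
  have exp_eq : Real.exp c * 2 ^ (b * n) = Real.exp (c * (n + 1)) * (2 : ℝ) ^ (a * n) := by
    simp only [Real.rpow_def_of_pos two_pos, ← Real.exp_add, c]
    ring_nf
  have pow_le : (n + 1 : ℝ) ^ D ≤ D.factorial / c ^ D * Real.exp (c * (n + 1)) := by
    have h := Real.pow_div_factorial_le_exp (c * (n + 1)) (by positivity) D
    rw [mul_pow, div_le_iff₀ (by positivity)] at h
    rw [div_mul_eq_mul_div, le_div_iff₀ (by positivity)]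
    linarith
  calc (n + 1 : ℝ) ^ D * 2 ^ (a * n)
      ≤ D.factorial / c ^ D * Real.exp (c * (n + 1)) * 2 ^ (a * n) := by gcongr
    _ = D.factorial / c ^ D * Real.exp c * 2 ^ (b * n) := by
      rw [mul_assoc, ← exp_eq, mul_assoc]

namespace CNF3

variable {ε : ℝ}

theorem mul_numSteps_toWorkflow (ε : ℝ) (φ : CNF3) :
    ε * (φ.toWorkflow.numSteps : ℝ) = 6 * ε * φ.numVars + ε := by
  change ε * ((3 * (φ.numVars * 2) + 1 : ℕ) : ℝ) = _
  push_cast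
  ring

theorem one_add_log_two_rpow_le (hε : 0 ≤ ε) (φ : CNF3) :
    1 + Real.log (2 ^ (ε * (φ.toWorkflow.numSteps : ℝ))) ≤ (1 + 6 * ε) * (φ.numVars + 1) := by
  rw [Real.log_rpow two_pos]
  have log_le : ε * φ.toWorkflow.numSteps * Real.log 2 ≤ ε * φ.toWorkflow.numSteps :=
    mul_le_of_le_one_right (by positivity) (by linarith [Real.log_two_lt_d9])
  have numVars_nonneg := φ.numVars.cast_nonneg (α := ℝ)
  rw [mul_numSteps_toWorkflow] at log_le ⊢
  linarith

theorem exists_time_toWorkflow_le (hε : 0 ≤ ε) (C : ℝ) (d e : ℕ) :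
    ∃ B : ℝ, 0 ≤ B ∧ ∀ φ : CNF3,
      C * ((2 : ℝ) ^ (ε * (φ.toWorkflow.numSteps : ℝ)) *
          (1 + Real.log ((2 : ℝ) ^ (ε * (φ.toWorkflow.numSteps : ℝ)))) ^ d) *
        (φ.toWorkflow.encode.length : ℝ) ^ e ≤
      B * ((φ.numVars + 1) ^ (d + 4 * e) * 2 ^ (6 * ε * φ.numVars)) := by
  refine ⟨|C| * 2 ^ ε * (1 + 6 * ε) ^ d * 400 ^ e, by positivity, fun φ => ?_⟩
  have log_le := one_add_log_two_rpow_le hε φ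
  have log_nonneg : 0 ≤ Real.log (2 ^ (ε * (φ.toWorkflow.numSteps : ℝ))) :=
    Real.log_nonneg (Real.one_le_rpow one_le_two (by positivity))
  have length_le : (φ.toWorkflow.encode.length : ℝ) ≤ 400 * (φ.numVars + 1) ^ 4 := by
    exact_mod_cast φ.length_encode_toWorkflow_le
  calc _ ≤ |C| * ((2 : ℝ) ^ (ε * (φ.toWorkflow.numSteps : ℝ)) *
          ((1 + 6 * ε) * (φ.numVars + 1)) ^ d) * (400 * (φ.numVars + 1) ^ 4) ^ e := by
        gcongr
        exact le_abs_self C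
    _ = _ := by
        rw [mul_numSteps_toWorkflow, Real.rpow_add two_pos, mul_pow, mul_pow, ← pow_mul, pow_add]
        ring

end CNF3

/-- Assuming the Exponential Time Hypothesis, there is `ε > 0` such that `WSP₂(≠)` with two users
cannot be solved in time `Õ(T)`, where `T = 2 ^ (ε k)` and `k` is the number of steps, not even if
in addition an arbitrary factor polynomial in the size of the instance is allowed. -/
theorem theorem4 (hETH : ExponentialTimeHypothesis) :
    ∃ ε : ℝ, 0 < ε ∧ ∀ (C : ℝ) (d e : ℕ),
      ¬ TwoUserWSP2NeSolvableWithin fun W =>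
        C * ((2 : ℝ) ^ (ε * (W.numSteps : ℝ)) *
            (1 + Real.log ((2 : ℝ) ^ (ε * (W.numSteps : ℝ)))) ^ d) *
          (W.encode.length : ℝ) ^ e := by
  obtain ⟨δ, hδ, hard⟩ := hETH
  refine ⟨δ / 12, by positivity, fun C d e solvable => ?_⟩
  obtain ⟨B, hB, time_le⟩ := CNF3.exists_time_toWorkflow_le (ε := δ / 12) (by positivity) C d e
  obtain ⟨B₁, reduction_le⟩ := exists_pow_mul_two_rpow_le hδ 4
  obtain ⟨B₂, algorithm_le⟩ :=
    exists_pow_mul_two_rpow_le (a := 6 * (δ / 12)) (b := δ) (by linarith) (d + 4 * e)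
  refine hard (886 * B₁ + B * B₂) (solvable.solvableWithin_cnf3.mono fun φ => ?_)
  have h₁ := reduction_le φ.numVars
  have h₂ := mul_le_mul_of_nonneg_left (algorithm_le φ.numVars) hB
  have h₃ := time_le φ
  rw [zero_mul, Real.rpow_zero, mul_one] at h₁
  linarith
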